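/- Let $n,m\ge 1$, $d\ge 0$ be integers and $A\in GL_n(\mathbb C)$ (its eigenvalues may be resonant). For every multi-index $i\in\mathbb N^m$ with $|i|=i_1+\dots+i_m\le d$ let $f_i:(\mathbb C^n,0)\to(\mathbb C^n,0)$ be a germ of holomorphic map with $f_i(z)=\mathcal O(\|z\|^2)$, and for $t\in\mathbb C^m$ put $$f_t(z)=Az+\sum_{|i|\le d}t^i f_i(z).$$ Suppose that for every $t\in\mathbb C^m$ we are given a formal linearization $h_t$ of $f_t$, i.e. an $n$-tuple of formal power series in $z=(z_1,\dots,z_n)$ with $h_t(0)=0$, $D_0h_t$ invertible (for example $D_0h_t=I$) and $h_t\circ f_t=A\circ h_t$ as formal power series. Suppose that there are constants $C_0,C_1>0$ such that, for every $\alpha\in\mathbb N^n$, the coefficient of $z^\alpha$ in each component of $h_t$ is a polynomial in $t$ of total degree at most $C_0+C_1|\alpha|$. Then exactly one of the following holds: 1) for every $t\in\mathbb C^m$ the series $h_t$ converges near $0$ and defines a germ of holomorphic diffeomorphism fixing $0$ with $h_t\circ f_t=A\circ h_t$ near $0$; 2) $h_t$ diverges (i.e. converges in no neighbourhood of $0$)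 for all $t\in\mathbb C^m$ outside a set $E\subset\mathbb C^m$ of $\Gamma$-capacity $0$. Here the capacity of $E\subset\mathbb C$ is the logarithmic capacity $\operatorname{cap}E=\sup_\mu \exp\big(-\iint\log\frac1{|z-w|}\,d\mu(z)\,d\mu(w)\big)$, the supremum over the Borel probability measures $\mu$ carried by a compact subset of $E$. The $\Gamma$-projection of $E\subset\mathbb C^{k}$, $k\ge2$, is $\Gamma^{k-1}_{k}(E)=\{z\in\mathbb C^{k-1}:\operatorname{cap}\{w\in\mathbb C:(z,w)\in E\}>0\}$; one sets $\Gamma_m^1=\Gamma_2^1\circ\dots\circ\Gamma_m^{m-1}$ (the identity for $m=1$), and the $\Gamma$-capacity of $E\subset\mathbb C^m$ is $\sup_{U}\operatorname{cap}\Gamma_m^1(U(E))$, the supremum over all unitary maps $U$ of $\mathbb C^m$. -/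

import Mathlib

open Filter Topology MeasureTheory
open scoped Matrix ENNReal

namespace SmallDivisors

/-! ### Logarithmic capacity in the plane and `Γ`-capacity in `ℂ^m` -/

/-- The logarithmic energy `I(μ) = ∬ log (1 / |z - w|) dμ(w) dμ(z)`, written as the difference of
the integrals of the positive and the negative part of the kernel; on the diagonal the kernel is
`+∞`. The second integral is finite when `μ` is a finite measure with compact support. -/
noncomputable def logEnergy (μ : Measure ℂ) : EReal :=
  ((∫⁻ z, ∫⁻ w, (-ENNReal.log (edist z w)).toENNReal ∂μ ∂μ : ℝ≥0∞) : EReal) -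
    ((∫⁻ z, ∫⁻ w, (ENNReal.log (edist z w)).toENNReal ∂μ ∂μ : ℝ≥0∞) : EReal)

/-- The logarithmic capacity of a set `E ⊆ ℂ`: the supremum of `exp (-I(μ))` over the Borel
probability measures `μ` carried by a compact subset of `E`. -/
noncomputable def logCapacity (E : Set ℂ) : ℝ≥0∞ :=
  ⨆ (μ : ProbabilityMeasure ℂ) (_ : ∃ K ⊆ E, IsCompact K ∧ (μ : Measure ℂ) Kᶜ = 0),
    EReal.exp (-logEnergy (μ : Measure ℂ))

/-- The `Γ`-projection of `E ⊆ ℂ^(m+1)` to `ℂ^m`: the points over which the fibre of `E` has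
positive capacity. -/
def gammaProj {m : ℕ} (E : Set (Fin (m + 1) → ℂ)) : Set (Fin m → ℂ) :=
  {z | 0 < logCapacity {w : ℂ | (Fin.snoc z w : Fin (m + 1) → ℂ) ∈ E}}

/-- The iterated `Γ`-projection of a subset of `ℂ^m` to `ℂ`, `m ≥ 1` (the value for `m = 0` is
a convention that is not used). -/
def gammaProjToLine : (m : ℕ) → Set (Fin m → ℂ) → Set ℂ
  | 0, _ => ∅
  | 1, E => {z : ℂ | (fun _ => z) ∈ E}
  | m + 2, E => gammaProjToLine (m + 1) (gammaProj E)

/-- The `Γ`-capacity of `E ⊆ ℂ^m`, `m ≥ 1`: the supremum over the unitary maps `U` of the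
capacity of the iterated `Γ`-projection of `U(E)` to `ℂ`. -/
noncomputable def gammaCapacity {m : ℕ} (E : Set (Fin m → ℂ)) : ℝ≥0∞ :=
  ⨆ U : Matrix.unitaryGroup (Fin m) ℂ,
    logCapacity (gammaProjToLine m ((fun t => (U : Matrix (Fin m) (Fin m) ℂ) *ᵥ t) '' E))

/-! ### Formal maps, germs and linearizations -/

/-- A formal map from `ℂ^n` to `ℂ^n`: an `n`-tuple of formal power series in `n` variables. -/
abbrev FormalMap (n : ℕ) : Type := Fin n → MvPowerSeries (Fin n) ℂ

/-- The term `c_α z^α` of the `j`-th component of a formal map. -/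
noncomputable def FormalMap.term {n : ℕ} (h : FormalMap n) (z : Fin n → ℂ) (j : Fin n)
    (α : Fin n →₀ ℕ) : ℂ :=
  MvPowerSeries.coeff α (h j) * ∏ k, z k ^ α k

/-- The formal map converges in a neighbourhood of the origin. -/
def FormalMap.Converges {n : ℕ} (h : FormalMap n) : Prop :=
  ∀ᶠ z : Fin n → ℂ in 𝓝 0, ∀ j, Summable (h.term z j)

/-- The formal map diverges: it converges in no neighbourhood of the origin. -/
def FormalMap.Diverges {n : ℕ} (h : FormalMap n) : Prop := ¬ h.Converges

/-- `g` is, near the origin, the sum of the formal map `φ`; in other words `φ` is the Taylor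
series of `g` at `0` and converges to `g`. -/
def HasExpansion {n : ℕ} (g : (Fin n → ℂ) → (Fin n → ℂ)) (φ : FormalMap n) : Prop :=
  ∀ᶠ z : Fin n → ℂ in 𝓝 0, ∀ j, HasSum (φ.term z j) (g z j)

/-- The matrix of the linear part `D_0 h` of a formal map. -/
noncomputable def FormalMap.linearPart {n : ℕ} (h : FormalMap n) : Matrix (Fin n) (Fin n) ℂ :=
  Matrix.of fun j k => MvPowerSeries.coeff (Finsupp.single k 1) (h j)

/-- `h` is a formal linearization of the germ at `0` of `g`: a formal change of variables
(`h(0) = 0`, `D_0 h` invertible) with `h ∘ g = A ∘ h` as formal power series, where `g` stands for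
its Taylor series at the origin. -/
def IsFormalLinearization {n : ℕ} (A : Matrix (Fin n) (Fin n) ℂ)
    (g : (Fin n → ℂ) → (Fin n → ℂ)) (h : FormalMap n) : Prop :=
  (∀ j, MvPowerSeries.constantCoeff (h j) = 0) ∧ IsUnit h.linearPart ∧
    ∃ φ : FormalMap n, HasExpansion g φ ∧
      ∀ j, MvPowerSeries.subst φ (h j) = ∑ k, A j k • h k

/-- `h` linearizes `g` holomorphically: `h` converges near `0` to a germ `H` of holomorphic
diffeomorphism fixing `0`, and `H ∘ g = A ∘ H` near `0`. -/
def HolomorphicallyLinearizes {n : ℕ} (A : Matrix (Fin n) (Fin n) ℂ)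
    (g : (Fin n → ℂ) → (Fin n → ℂ)) (h : FormalMap n) : Prop :=
  ∃ H : (Fin n → ℂ) → (Fin n → ℂ), HasExpansion H h ∧
    AnalyticAt ℂ H 0 ∧ H 0 = 0 ∧ (fderiv ℂ H 0).IsInvertible ∧
    ∀ᶠ z in 𝓝 0, H (g z) = A *ᵥ H z

/-- The polynomial family `f_t(z) = A z + ∑_{|i| ≤ d} t^i f_i(z)`. -/
noncomputable def polyFamily {n m : ℕ} (A : Matrix (Fin n) (Fin n) ℂ) (d : ℕ)
    (f : (Fin m → ℕ) → (Fin n → ℂ) → (Fin n → ℂ)) (t : Fin m → ℂ) (z : Fin n → ℂ) : Fin n → ℂ :=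
  A *ᵥ z + ∑ i ∈ (Finset.Icc 0 (fun _ : Fin m => d)).filter (fun i => ∑ k, i k ≤ d),
    (∏ k, t k ^ i k) • f i z

end SmallDivisors

/-!
The set of parameters where `h t` converges is the union of the compact sets `E k` of those `t`
with `‖t‖ ≤ k` for which all coefficients of order `N` of `h t` are at most `k ^ N`. These
coefficients are polynomials in `t` of degree `O(N)`. So the theorem follows from an inequality of
Bernstein–Walsh type (`exists_growth_of_gammaCapacity_ne_zero`): if the union has positive
`Γ`-capacity, then for some `k` and every `t` a polynomial of degree at most `D` satisfies
`|p t| ≤ C(t) ^ D * sup_{E k} |p|`. At every `t` the coefficients of order `N` then grow at most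
exponentially in `N`, and `h t` converges.

*One variable.* A measure of finite energy has a finite potential almost everywhere, hence, after
restriction to a compact set of positive measure, a potential bounded on its support, and then, up
to the constant `log 2`, in the whole plane (`exists_bounded_potential`). Averaging
`∑ log⁺ (1 / |w - a|)` over the roots `a` of a polynomial `q` gives a point `w` of the support where
`|q|` is not small compared with its value at any other given point
(`bernsteinWalsh_of_bounded_potential`).

*Several variables.* The set of points `z` over which the fibre of `E k` has positive capacity need
not be closed, but it is contained in the union over `N` of the sets of `z` over which the fibre
satisfies the one-variable inequality with constant `N`. These are compact
(`isCompact_bernsteinWalshProj`), so that induction on the dimension applies.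

*From formal to holomorphic.* A convergent series is analytic (`analyticAt_and_hasFDerivAt`), and
formal substitution of convergent series without constant term is composition of the sums, by
absolute convergence of the double series (`eventually_hasSum_subst`). So a convergent formal
linearization is a holomorphic one.

The alternatives exclude each other because the plane has positive capacity: the uniform measure
on a segment has finite energy (`logCapacity_univ_pos`).
-/

namespace SmallDivisors

/-! ### Bounded potentials and the Bernstein–Walsh inequality in the plane -/

/-- The positive part `log⁺ (1 / |z - w|)` of the logarithmic kernel. -/
noncomputable def posKernel (z w : ℂ) : ℝ≥0∞ := (-ENNReal.log (edist z w)).toENNReal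

lemma posKernel_self (z : ℂ) : posKernel z z = ⊤ := by simp [posKernel]

lemma posKernel_of_ne {z w : ℂ} (h : z ≠ w) :
    posKernel z w = ENNReal.ofReal (-Real.log (dist z w)) := by
  have hd : 0 < dist z w := dist_pos.2 h
  rw [posKernel, edist_dist, ENNReal.log_ofReal_of_pos hd, ← EReal.coe_neg,
    EReal.real_coe_toENNReal]

lemma measurable_posKernel : Measurable (fun p : ℂ × ℂ => posKernel p.1 p.2) := by
  have h : Measurable fun p : ℂ × ℂ => ENNReal.log (edist p.1 p.2) :=
    ENNReal.measurable_log.comp measurable_edist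
  have h' : Measurable fun p : ℂ × ℂ => -ENNReal.log (edist p.1 p.2) :=
    continuous_neg.measurable.comp h
  exact measurable_ereal_toENNReal.comp h'

lemma measurable_posKernel_right (z : ℂ) : Measurable (posKernel z) :=
  Measurable.of_uncurry_left (f := posKernel) measurable_posKernel

lemma logEnergy_eq (μ : Measure ℂ) : logEnergy μ =
    ((∫⁻ z, ∫⁻ w, posKernel z w ∂μ ∂μ : ℝ≥0∞) : EReal) -
    ((∫⁻ z, ∫⁻ w, (ENNReal.log (edist z w)).toENNReal ∂μ ∂μ : ℝ≥0∞) : EReal) := rfl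

lemma logCapacity_mono {E F : Set ℂ} (h : E ⊆ F) : logCapacity E ≤ logCapacity F := by
  unfold logCapacity
  refine iSup_mono fun μ => iSup_le fun ⟨K, hKE, hK, hμ⟩ => ?_
  exact le_iSup_of_le ⟨K, hKE.trans h, hK, hμ⟩ le_rfl

lemma gammaProj_mono {m : ℕ} {E F : Set (Fin (m + 1) → ℂ)} (h : E ⊆ F) :
    gammaProj E ⊆ gammaProj F := fun _ hz =>
  lt_of_lt_of_le hz (logCapacity_mono fun _ hw => h hw)

lemma gammaProjToLine_mono : ∀ (m : ℕ) {E F : Set (Fin m → ℂ)}, E ⊆ F →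
    gammaProjToLine m E ⊆ gammaProjToLine m F
  | 0, _, _, _ => subset_rfl
  | 1, _, _, h => fun _ hz => h hz
  | m + 2, _, _, h => gammaProjToLine_mono (m + 1) (gammaProj_mono h)

lemma gammaCapacity_mono {m : ℕ} {E F : Set (Fin m → ℂ)} (h : E ⊆ F) :
    gammaCapacity E ≤ gammaCapacity F :=
  iSup_mono fun _ => logCapacity_mono (gammaProjToLine_mono m (Set.image_mono h))

/-- A compactly supported measure of finite logarithmic energy has finite positive energy: the
negative part of the kernel is bounded on the support, so no `⊤ - ⊤` occurs. -/
lemma lintegral_posKernel_ne_top {μ : Measure ℂ} [IsFiniteMeasure μ] {K : Set ℂ}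
    (hK : IsCompact K) (hμ : μ Kᶜ = 0) (h : logEnergy μ ≠ ⊤) :
    ∫⁻ z, ∫⁻ w, posKernel z w ∂μ ∂μ ≠ ⊤ := by
  intro htop
  apply h
  have hae : ∀ᵐ z ∂μ, z ∈ K := by rw [ae_iff]; exact hμ
  have hd : Metric.ediam K ≠ ⊤ := hK.isBounded.ediam_ne_top
  have hfin : ∫⁻ z, ∫⁻ w, (ENNReal.log (edist z w)).toENNReal ∂μ ∂μ ≠ ⊤ := by
    refine ne_top_of_le_ne_top (b := ∫⁻ _, ∫⁻ _,
      (ENNReal.log (Metric.ediam K)).toENNReal ∂μ ∂μ) ?_ ?_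
    · have : (ENNReal.log (Metric.ediam K)).toENNReal ≠ ⊤ := by
        rw [EReal.toENNReal_ne_top_iff]; simpa using hd
      simp only [lintegral_const]
      exact ENNReal.mul_ne_top (ENNReal.mul_ne_top this (measure_ne_top _ _))
        (measure_ne_top _ _)
    · refine lintegral_mono_ae (hae.mono fun z hz => lintegral_mono_ae (hae.mono fun w hw => ?_))
      exact EReal.toENNReal_le_toENNReal
        (ENNReal.log_monotone (Metric.edist_le_ediam_of_mem hz hw))
  rw [logEnergy_eq, htop]
  lift (∫⁻ z, ∫⁻ w, (ENNReal.log (edist z w)).toENNReal ∂μ ∂μ) to NNReal using hfin with c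
  exact EReal.top_sub_coe _

/-- A weak form of the maximum principle for potentials: it is applied with `w₀` a point of the
support closest to `z`, so that the potential at `z` exceeds that at `w₀` by at most `log 2` times
the mass. -/
lemma posKernel_le_add_of_dist_le {z w w₀ : ℂ} (h : dist w₀ w ≤ 2 * dist z w) :
    posKernel z w ≤ ENNReal.ofReal (Real.log 2) + posKernel w₀ w := by
  by_cases h0 : w₀ = w
  · simp [h0, posKernel_self]
  have hz : z ≠ w := by
    rintro rfl
    simp only [dist_self, mul_zero] at h
    exact h0 (dist_le_zero.1 h)
  rw [posKernel_of_ne h0, posKernel_of_ne hz]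
  refine le_trans (ENNReal.ofReal_le_ofReal ?_) ENNReal.ofReal_add_le
  have := Real.log_le_log (dist_pos.2 h0) h
  rw [Real.log_mul two_ne_zero (dist_pos.2 hz).ne'] at this
  linarith

/-- A set of positive capacity which is a countable increasing union of closed sets carries a
probability measure with bounded potential, supported in a compact subset of one of these sets. -/
lemma exists_bounded_potential {E : ℕ → Set ℂ} (hmono : Monotone E) (hcl : ∀ k, IsClosed (E k))
    (h : 0 < logCapacity (⋃ k, E k)) :
    ∃ k, ∃ K ⊆ E k, IsCompact K ∧ ∃ ν : Measure ℂ, IsProbabilityMeasure ν ∧ ν Kᶜ = 0 ∧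
      ∃ N : ℝ≥0∞, N ≠ ⊤ ∧ ∀ z, ∫⁻ w, posKernel z w ∂ν ≤ N := by
  obtain ⟨μ, hμ⟩ := lt_iSup_iff.1 h
  obtain ⟨⟨K₀, hK₀E, hK₀, hμK₀⟩, hμpos⟩ := lt_iSup_iff.1 hμ
  have hE : logEnergy (μ : Measure ℂ) ≠ ⊤ := by
    intro htop
    simp [htop] at hμpos
  have hfin := lintegral_posKernel_ne_top hK₀ hμK₀ hE
  generalize hm : (μ : Measure ℂ) = m at *
  have hmp : IsProbabilityMeasure m := by rw [← hm]; infer_instance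
  set U : ℂ → ℝ≥0∞ := fun z => ∫⁻ w, posKernel z w ∂m with hU
  have hUm : Measurable U := measurable_posKernel.lintegral_prod_right'
  have hUae : ∀ᵐ z ∂m, U z < ⊤ := ae_lt_top hUm hfin
  -- the sets on which the potential is bounded and which lie in one `E k` exhaust `m`
  set S : ℕ → Set ℂ := fun k => {z | U z ≤ k} ∩ (E k ∩ K₀) with hS
  have hSm : ∀ k, MeasurableSet (S k) := fun k =>
    (measurableSet_le hUm measurable_const).inter
      ((hcl k).measurableSet.inter hK₀.measurableSet)
  have hex : ∃ k, m (S k) ≠ 0 := by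
    by_contra! hno
    have h1 : m (⋃ k, S k) = 0 := measure_iUnion_null hno
    have h2 : ∀ᵐ z ∂m, z ∈ ⋃ k, S k := by
      have hK : ∀ᵐ z ∂m, z ∈ K₀ := by rw [ae_iff]; exact hμK₀
      filter_upwards [hUae, hK] with z hz hzK
      obtain ⟨k, hk⟩ := Set.mem_iUnion.1 (hK₀E hzK)
      obtain ⟨l, hl⟩ := ENNReal.exists_nat_gt hz.ne
      refine Set.mem_iUnion.2 ⟨max k l, ⟨?_, hmono (le_max_left _ _) hk, hzK⟩⟩
      exact hl.le.trans (by exact_mod_cast le_max_right k l)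
    have h3 : ∀ᵐ z ∂m, z ∉ ⋃ k, S k := by
      rw [ae_iff]; simpa only [not_not, Set.ofPred_mem_eq] using h1
    have h4 : ∀ᵐ z ∂m, False := by filter_upwards [h2, h3] with z a b using b a
    rw [ae_iff] at h4
    simp at h4
  obtain ⟨k, hk⟩ := hex
  obtain ⟨K, hKS, hK, hKpos⟩ := (hSm k).exists_lt_isCompact (μ := m) (pos_iff_ne_zero.2 hk)
  have hKne : K.Nonempty := by
    rw [Set.nonempty_iff_ne_empty]; rintro rfl; simp at hKpos
  refine ⟨k, K, fun z hz => (hKS hz).2.1, hK, ProbabilityTheory.cond m K,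
    ProbabilityTheory.cond_isProbabilityMeasure hKpos.ne', ?_,
    (m K)⁻¹ * (ENNReal.ofReal (Real.log 2) + k), ?_, ?_⟩
  · rw [ProbabilityTheory.cond_apply hK.measurableSet]; simp
  · exact ENNReal.mul_ne_top (ENNReal.inv_ne_top.2 hKpos.ne')
      (ENNReal.add_ne_top.2 ⟨ENNReal.ofReal_ne_top, ENNReal.natCast_ne_top k⟩)
  · intro z
    obtain ⟨w₀, hw₀, hmin⟩ := hK.exists_infDist_eq_dist hKne z
    rw [ProbabilityTheory.cond, lintegral_smul_measure, smul_eq_mul]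
    refine mul_le_mul_right ?_ _
    calc ∫⁻ w in K, posKernel z w ∂m
        ≤ ∫⁻ w in K, (ENNReal.ofReal (Real.log 2) + posKernel w₀ w) ∂m := by
          refine setLIntegral_mono' hK.measurableSet fun w hw => posKernel_le_add_of_dist_le ?_
          have h1 : dist z w₀ ≤ dist z w := hmin ▸ Metric.infDist_le_dist_of_mem hw
          have h2 := dist_triangle w₀ z w
          rw [dist_comm w₀ z] at h2
          linarith
      _ ≤ ∫⁻ w, (ENNReal.ofReal (Real.log 2) + posKernel w₀ w) ∂m :=
          setLIntegral_le_lintegral _ _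
      _ = ENNReal.ofReal (Real.log 2) + U w₀ := by
          rw [lintegral_add_left measurable_const]; simp [hU]
      _ ≤ _ := by gcongr; exact (hKS hw₀).1

/-- The **Bernstein–Walsh property** of a plane set with constant `N`: a polynomial of degree at
most `D` is bounded at `w` by `(N (1 + |w|)) ^ D` times one of its values on the set. -/
def BernsteinWalsh (F : Set ℂ) (N : ℝ) : Prop :=
  ∀ (D : ℕ) (q : Polynomial ℂ), q.natDegree ≤ D → ∀ w, ∃ w' ∈ F,
    ‖q.eval w‖ ≤ (N * (1 + ‖w‖)) ^ D * ‖q.eval w'‖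

lemma norm_sub_le_mul_exp_posKernel {a w w' : ℂ} (h : posKernel a w' ≠ ⊤) :
    ‖w - a‖ ≤ (1 + dist w w') * Real.exp (posKernel a w').toReal * ‖w' - a‖ := by
  have hne : a ≠ w' := by rintro rfl; exact h (posKernel_self _)
  have hpos : 0 < ‖w' - a‖ := norm_pos_iff.2 (sub_ne_zero.2 hne.symm)
  have h1 : 1 ≤ Real.exp (posKernel a w').toReal := Real.one_le_exp ENNReal.toReal_nonneg
  have h2 : 1 ≤ Real.exp (posKernel a w').toReal * ‖w' - a‖ := by
    rw [posKernel_of_ne hne, dist_comm, dist_eq_norm]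
    calc (1 : ℝ) = Real.exp (-Real.log ‖w' - a‖) * ‖w' - a‖ := by
          rw [Real.exp_neg, Real.exp_log hpos, inv_mul_cancel₀ hpos.ne']
      _ ≤ _ := by
          gcongr
          rw [ENNReal.toReal_ofReal']; exact le_max_left _ _
  have h3 : ‖w - a‖ ≤ dist w w' + ‖w' - a‖ := by
    rw [dist_eq_norm]; simpa using norm_add_le (w - w') (w' - a)
  have h4 : 0 ≤ dist w w' := dist_nonneg
  calc ‖w - a‖ ≤ dist w w' * 1 + 1 * ‖w' - a‖ := by linarith
    _ ≤ dist w w' * (Real.exp (posKernel a w').toReal * ‖w' - a‖) +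
        Real.exp (posKernel a w').toReal * ‖w' - a‖ := by gcongr
    _ = _ := by ring

/-- Averaging over `ν`, some point `w'` of `K` has `∑ log⁺ (1 / |a - w'|) ≤ N * D` over the roots `a`
of the polynomial, and the factors of the polynomial are compared one by one at `w` and `w'`. -/
lemma bernsteinWalsh_of_bounded_potential {K : Set ℂ} (hK : IsCompact K) {ν : Measure ℂ}
    [IsProbabilityMeasure ν] (hν : ν Kᶜ = 0) {N : ℝ≥0∞} (hN : N ≠ ⊤)
    (h : ∀ z, ∫⁻ w, posKernel z w ∂ν ≤ N) : ∃ C, 0 ≤ C ∧ BernsteinWalsh K C := by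
  obtain ⟨R, hR, hKR⟩ : ∃ R : ℝ, 0 ≤ R ∧ ∀ w ∈ K, ‖w‖ ≤ R := by
    obtain ⟨R, hR⟩ := hK.isBounded.exists_norm_le
    exact ⟨max R 0, le_max_right _ _, fun w hw => (hR w hw).trans (le_max_left _ _)⟩
  refine ⟨(1 + R) * Real.exp N.toReal, by positivity, fun D q hq w => ?_⟩
  -- on average over `ν`, hence at some point `w'` of `K`, the roots contribute at most `N` each
  obtain ⟨w', hw'K, hw'⟩ : ∃ w' ∉ Kᶜ, (q.roots.map fun a => posKernel a w').sum ≤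
      ∫⁻ w, (q.roots.map fun a => posKernel a w).sum ∂ν := by
    refine exists_notMem_null_le_lintegral ?_ hν
    induction q.roots using Multiset.induction with
    | empty => simp
    | cons a s ih =>
      simp only [Multiset.map_cons, Multiset.sum_cons]
      exact (measurable_posKernel_right a).aemeasurable.add ih
  have hsum : ∀ s : Multiset ℂ, ∫⁻ w, (s.map fun a => posKernel a w).sum ∂ν ≤ s.card * N := by
    intro s
    induction s using Multiset.induction with
    | empty => simp
    | cons a s ih =>
      simp only [Multiset.map_cons, Multiset.sum_cons, Multiset.card_cons, Nat.cast_add,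
        Nat.cast_one]
      rw [lintegral_add_left (measurable_posKernel_right a), add_mul, one_mul, add_comm]
      exact add_le_add ih (h a)
  have hle := hw'.trans (hsum q.roots)
  rw [Set.notMem_compl_iff] at hw'K
  refine ⟨w', hw'K, ?_⟩
  have hprod : ∀ s : Multiset ℂ, (s.map fun a => posKernel a w').sum ≠ ⊤ →
      (s.map fun a => ‖w - a‖).prod ≤ (1 + dist w w') ^ s.card *
        Real.exp (s.map fun a => posKernel a w').sum.toReal *
          (s.map fun a => ‖w' - a‖).prod := by
    intro s
    induction s using Multiset.induction with
    | empty => simp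
    | cons a s ih =>
      simp only [Multiset.map_cons, Multiset.sum_cons, Multiset.card_cons, Multiset.prod_cons]
      intro hne
      obtain ⟨h1, h2⟩ := ENNReal.add_ne_top.1 hne
      rw [ENNReal.toReal_add h1 h2, Real.exp_add]
      calc _ ≤ ((1 + dist w w') * Real.exp (posKernel a w').toReal * ‖w' - a‖) * _ :=
            mul_le_mul (norm_sub_le_mul_exp_posKernel h1) (ih h2)
              (Multiset.prod_nonneg
                (by simp only [Multiset.mem_map]; rintro _ ⟨x, -, rfl⟩; positivity))
              (by positivity)
        _ = _ := by ring
  have hev : ∀ x, ‖q.eval x‖ = ‖q.leadingCoeff‖ * (q.roots.map fun a => ‖x - a‖).prod := by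
    intro x
    conv_lhs => rw [(IsAlgClosed.splits q).eq_prod_roots]
    rw [Polynomial.eval_mul, Polynomial.eval_C, norm_mul, Polynomial.eval_multiset_prod,
      Multiset.map_map]
    congr 1
    induction q.roots using Multiset.induction with
    | empty => simp
    | cons a s ih => simpa using Or.inl ih
  have hcard : q.roots.card ≤ D := (Polynomial.card_roots' q).trans hq
  have hNtop : (q.roots.card : ℝ≥0∞) * N ≠ ⊤ := ENNReal.mul_ne_top (ENNReal.natCast_ne_top _) hN
  have hexp : Real.exp (q.roots.map fun a => posKernel a w').sum.toReal ≤
      Real.exp N.toReal ^ q.roots.card := by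
    rw [← Real.exp_nat_mul]
    apply Real.exp_le_exp.2
    have := ENNReal.toReal_mono hNtop hle
    simpa using this
  have hdist : 1 + dist w w' ≤ (1 + R) * (1 + ‖w‖) := by
    have h1 : dist w w' ≤ ‖w‖ + ‖w'‖ := by rw [dist_eq_norm]; exact norm_sub_le _ _
    have h2 := hKR w' hw'K
    nlinarith [norm_nonneg w]
  have hone : 1 ≤ (1 + R) * Real.exp N.toReal * (1 + ‖w‖) := by
    have h1 : 1 ≤ Real.exp N.toReal := Real.one_le_exp ENNReal.toReal_nonneg
    have h2 : 1 ≤ 1 + R := by linarith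
    have h3 : 1 ≤ 1 + ‖w‖ := by linarith [norm_nonneg w]
    exact one_le_mul_of_one_le_of_one_le (one_le_mul_of_one_le_of_one_le h2 h1) h3
  have hP : 0 ≤ (q.roots.map fun a => ‖w' - a‖).prod :=
    Multiset.prod_nonneg (by simp only [Multiset.mem_map]; rintro _ ⟨x, -, rfl⟩; positivity)
  rw [hev w, hev w']
  calc ‖q.leadingCoeff‖ * (q.roots.map fun a => ‖w - a‖).prod
      ≤ ‖q.leadingCoeff‖ * ((((1 + R) * (1 + ‖w‖)) ^ q.roots.card *
        Real.exp N.toReal ^ q.roots.card) * (q.roots.map fun a => ‖w' - a‖).prod) := by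
        gcongr
        exact (hprod _ (ne_top_of_le_ne_top hNtop hle)).trans (by gcongr)
    _ = ((1 + R) * Real.exp N.toReal * (1 + ‖w‖)) ^ q.roots.card *
        (‖q.leadingCoeff‖ * (q.roots.map fun a => ‖w' - a‖).prod) := by
        rw [← mul_pow]; ring
    _ ≤ _ := by
        gcongr

lemma BernsteinWalsh.mono {F G : Set ℂ} {M N : ℝ} (h : BernsteinWalsh F M) (hFG : F ⊆ G)
    (hM : 0 ≤ M) (hMN : M ≤ N) : BernsteinWalsh G N := by
  intro D q hq w
  obtain ⟨w', hw', hle⟩ := h D q hq w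
  exact ⟨w', hFG hw', hle.trans (by gcongr)⟩

lemma exists_bernsteinWalsh {E : ℕ → Set ℂ} (hmono : Monotone E) (hcl : ∀ k, IsClosed (E k))
    (h : 0 < logCapacity (⋃ k, E k)) : ∃ k : ℕ, BernsteinWalsh (E k) k := by
  obtain ⟨k, K, hKE, hK, ν, hν, hνK, N, hN, hle⟩ := exists_bounded_potential hmono hcl h
  obtain ⟨C, hC0, hC⟩ := bernsteinWalsh_of_bounded_potential hK hνK hN hle
  obtain ⟨l, hl⟩ := exists_nat_ge C
  refine ⟨max k l, hC.mono (hKE.trans (hmono (le_max_left _ _))) hC0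
    (hl.trans (by exact_mod_cast le_max_right k l))⟩

/-! ### The Bernstein–Walsh inequality for sets of positive `Γ`-capacity -/

/-- A function on `ℂ^m` whose restriction to every complex line is a polynomial of degree at most
`D`. Polynomials of total degree at most `D` are of this kind; unlike these, the class is visibly
stable under linear changes of variables and under restriction to coordinate subspaces. -/
def PolyOnLines {m : ℕ} (D : ℕ) (p : (Fin m → ℂ) → ℂ) : Prop :=
  ∀ a b, ∃ q : Polynomial ℂ, q.natDegree ≤ D ∧ ∀ s : ℂ, p (a + s • b) = q.eval s

lemma PolyOnLines.comp_snoc_right {m D : ℕ} {p : (Fin (m + 1) → ℂ) → ℂ} (hp : PolyOnLines D p)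
    (w : ℂ) : PolyOnLines D fun z : Fin m → ℂ => p (Fin.snoc z w : Fin (m + 1) → ℂ) := by
  intro a b
  obtain ⟨q, hq, h⟩ := hp (Fin.snoc a w) (Fin.snoc b 0)
  refine ⟨q, hq, fun s => ?_⟩
  rw [← h s]
  change p _ = p _
  congr 1
  funext i
  refine Fin.lastCases ?_ (fun i => ?_) i <;> simp

lemma PolyOnLines.exists_eval_snoc {m D : ℕ} {p : (Fin (m + 1) → ℂ) → ℂ} (hp : PolyOnLines D p)
    (z : Fin m → ℂ) : ∃ q : Polynomial ℂ, q.natDegree ≤ D ∧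
      ∀ w, p (Fin.snoc z w : Fin (m + 1) → ℂ) = q.eval w := by
  obtain ⟨q, hq, h⟩ := hp (Fin.snoc z 0) (Fin.snoc 0 1)
  refine ⟨q, hq, fun w => ?_⟩
  rw [← h w]
  congr 1
  funext i
  refine Fin.lastCases ?_ (fun i => ?_) i <;> simp

lemma PolyOnLines.comp_mulVec {m D : ℕ} {p : (Fin m → ℂ) → ℂ} (hp : PolyOnLines D p)
    (V : Matrix (Fin m) (Fin m) ℂ) : PolyOnLines D fun t => p (V *ᵥ t) := by
  intro a b
  obtain ⟨q, hq, h⟩ := hp (V *ᵥ a) (V *ᵥ b)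
  refine ⟨q, hq, fun s => ?_⟩
  rw [← h s, ← Matrix.mulVec_smul, ← Matrix.mulVec_add]

/-- The points over which the fibre of `E` has the Bernstein–Walsh property with constant `N`. -/
def bernsteinWalshProj {m : ℕ} (E : Set (Fin (m + 1) → ℂ)) (N : ℝ) : Set (Fin m → ℂ) :=
  {z | BernsteinWalsh {w : ℂ | (Fin.snoc z w : Fin (m + 1) → ℂ) ∈ E} N}

lemma continuous_snoc_right {m : ℕ} (z : Fin m → ℂ) :
    Continuous fun w : ℂ => (Fin.snoc z w : Fin (m + 1) → ℂ) := by
  exact continuous_const.finSnoc continuous_id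

/-- Unlike the set of points with fibre of positive capacity, the set of points whose fibre
satisfies the Bernstein–Walsh inequality with a given constant is compact: it is an intersection
of projections of compact sets. -/
lemma isCompact_bernsteinWalshProj {m : ℕ} {E : Set (Fin (m + 1) → ℂ)} (hE : IsCompact E) (N : ℝ) :
    IsCompact (bernsteinWalshProj E N) := by
  have hinit : Continuous (fun x : Fin (m + 1) → ℂ => (fun i : Fin m => x i.castSucc)) := by
    fun_prop
  set S : (x : (Σ D : ℕ, {q : Polynomial ℂ // q.natDegree ≤ D}) × ℂ) → Set (Fin m → ℂ) := fun x =>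
    (fun y : Fin (m + 1) → ℂ => (fun i : Fin m => y i.castSucc)) ''
      (E ∩ {y | ‖x.1.2.1.eval x.2‖ ≤ (N * (1 + ‖x.2‖)) ^ x.1.1 * ‖x.1.2.1.eval (y (Fin.last m))‖})
    with hS
  have hSc : ∀ x, IsCompact (S x) := fun x => by
    refine (hE.inter_right ?_).image hinit
    refine isClosed_le continuous_const (continuous_const.mul ?_)
    exact (x.1.2.1.continuous.comp (continuous_apply _)).norm
  have hEq : bernsteinWalshProj E N = ⋂ x, S x := by
    ext z
    simp only [bernsteinWalshProj, BernsteinWalsh, Set.mem_ofPred_eq, Set.mem_iInter]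
    constructor
    · rintro h ⟨⟨D, q, hq⟩, w⟩
      obtain ⟨w', hw', hle⟩ := h D q hq w
      exact ⟨_, ⟨hw', by simpa using hle⟩, by simp⟩
    · intro h D q hq w
      obtain ⟨y, ⟨hy, hle⟩, rfl⟩ := h ⟨⟨D, q, hq⟩, w⟩
      refine ⟨y (Fin.last m), ?_, hle⟩
      have : (Fin.snoc (fun i : Fin m => y i.castSucc) (y (Fin.last m)) : Fin (m + 1) → ℂ) = y :=
        Fin.snoc_init_self y
      simpa [this] using hy
  rw [hEq]
  exact (hSc ⟨⟨0, 0, by simp⟩, 0⟩).of_isClosed_subset (isClosed_iInter fun x => (hSc x).isClosed)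
    (Set.iInter_subset _ _)

/-- The Bernstein–Walsh inequality in several variables, for an increasing union of compact sets
with an iterated `Γ`-projection of positive capacity. -/
lemma exists_growth_of_logCapacity_pos (m : ℕ) : ∀ {E : ℕ → Set (Fin (m + 1) → ℂ)},
    Monotone E → (∀ k, IsCompact (E k)) →
    0 < logCapacity (gammaProjToLine (m + 1) (⋃ k, E k)) →
    ∃ k, ∃ C : (Fin (m + 1) → ℂ) → ℝ, ∀ t, 0 ≤ C t ∧
      ∀ D p, PolyOnLines D p → ∃ t' ∈ E k, ‖p t‖ ≤ C t ^ D * ‖p t'‖ := by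
  induction m with
  | zero =>
    intro E hmono hE h
    set c : ℂ → Fin (0 + 1) → ℂ := fun z _ => z with hc
    have hcc : Continuous c := continuous_pi fun _ => continuous_id
    have heq : gammaProjToLine (0 + 1) (⋃ k, E k) = ⋃ k, c ⁻¹' E k := by
      rw [← Set.preimage_iUnion]
      rfl
    rw [heq] at h
    obtain ⟨k, hk⟩ := exists_bernsteinWalsh (E := fun k => c ⁻¹' E k)
      (fun i j hij => Set.preimage_mono (hmono hij))
      (fun k => (hE k).isClosed.preimage hcc) h
    refine ⟨k, fun t => k * (1 + ‖t 0‖), fun t => ⟨by positivity, fun D p hp => ?_⟩⟩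
    obtain ⟨q, hq, hpq⟩ := hp 0 (fun _ => 1)
    obtain ⟨w', hw', hle⟩ := hk D q hq (t 0)
    rw [← hpq, ← hpq] at hle
    refine ⟨_, hw', ?_⟩
    convert hle using 4
    · ext i; fin_cases i; simp
    · ext i; simp [hc]
  | succ m ih =>
    intro E hmono hE h
    have hsub : gammaProj (⋃ k, E k) ⊆ ⋃ k : ℕ, bernsteinWalshProj (E k) k := by
      intro z hz
      set c : ℂ → Fin (m + 1 + 1) → ℂ := fun w => Fin.snoc z w with hc
      have hz' : 0 < logCapacity (c ⁻¹' ⋃ k, E k) := hz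
      rw [Set.preimage_iUnion] at hz'
      obtain ⟨k, hk⟩ := exists_bernsteinWalsh (E := fun k => c ⁻¹' E k)
        (fun i j hij => Set.preimage_mono (hmono hij))
        (fun k => (hE k).isClosed.preimage (continuous_snoc_right z)) hz'
      exact Set.mem_iUnion.2 ⟨k, hk⟩
    have hpos : 0 < logCapacity (gammaProjToLine (m + 1) (⋃ k : ℕ, bernsteinWalshProj (E k) k)) :=
      lt_of_lt_of_le h (logCapacity_mono (gammaProjToLine_mono (m + 1) hsub))
    obtain ⟨k, C, hC⟩ := ih (E := fun k => bernsteinWalshProj (E k) k)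
      (fun i j hij z hz => BernsteinWalsh.mono hz (fun w hw => hmono hij hw) (Nat.cast_nonneg i)
        (by exact_mod_cast hij)) (fun k => isCompact_bernsteinWalshProj (hE k) k) hpos
    refine ⟨k, fun t => C (Fin.init t) * (k * (1 + ‖t (Fin.last _)‖)), fun t =>
      ⟨mul_nonneg (hC _).1 (by positivity), fun D p hp => ?_⟩⟩
    obtain ⟨z', hz', hle⟩ := (hC (Fin.init t)).2 D _ (hp.comp_snoc_right (t (Fin.last _)))
    obtain ⟨q, hq, hpq⟩ := hp.exists_eval_snoc z'
    obtain ⟨w', hw', hle'⟩ := hz' D q hq (t (Fin.last _))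
    refine ⟨_, hw', ?_⟩
    rw [Fin.snoc_init_self, hpq] at hle
    rw [hpq, mul_pow, mul_assoc]
    exact hle.trans (mul_le_mul_of_nonneg_left hle' (pow_nonneg (hC _).1 _))

/-- The Bernstein–Walsh inequality for an increasing union of compact sets of positive
`Γ`-capacity: one of these sets already controls the growth of all polynomials. -/
lemma exists_growth_of_gammaCapacity_ne_zero {m : ℕ} (hm : 1 ≤ m) {E : ℕ → Set (Fin m → ℂ)}
    (hmono : Monotone E) (hE : ∀ k, IsCompact (E k)) (h : gammaCapacity (⋃ k, E k) ≠ 0) :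
    ∃ k, ∃ C : (Fin m → ℂ) → ℝ, ∀ t, 0 ≤ C t ∧
      ∀ D p, PolyOnLines D p → ∃ t' ∈ E k, ‖p t‖ ≤ C t ^ D * ‖p t'‖ := by
  obtain ⟨m, rfl⟩ := Nat.exists_eq_add_of_le' hm
  obtain ⟨U, hU⟩ := lt_iSup_iff.1 (pos_iff_ne_zero.2 h)
  rw [Set.image_iUnion] at hU
  have hcont : Continuous fun t : Fin (m + 1) → ℂ =>
      (U : Matrix (Fin (m + 1)) (Fin (m + 1)) ℂ) *ᵥ t :=
    continuous_const.matrix_mulVec continuous_id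
  obtain ⟨k, C, hC⟩ := exists_growth_of_logCapacity_pos m
    (fun i j hij => Set.image_mono (hmono hij)) (fun k => (hE k).image hcont) hU
  have hinv : ∀ t, (star U : Matrix (Fin (m + 1)) (Fin (m + 1)) ℂ) *ᵥ
      ((U : Matrix (Fin (m + 1)) (Fin (m + 1)) ℂ) *ᵥ t) = t := fun t => by
    rw [Matrix.mulVec_mulVec, Matrix.UnitaryGroup.star_mul_self, Matrix.one_mulVec]
  refine ⟨k, fun t => C ((U : Matrix (Fin (m + 1)) (Fin (m + 1)) ℂ) *ᵥ t), fun t =>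
    ⟨(hC _).1, fun D p hp => ?_⟩⟩
  obtain ⟨_, ⟨t', ht', rfl⟩, hle⟩ := (hC ((U : Matrix (Fin (m + 1)) (Fin (m + 1)) ℂ) *ᵥ t)).2 D _
    (hp.comp_mulVec (star U : Matrix (Fin (m + 1)) (Fin (m + 1)) ℂ))
  simp only [hinv] at hle
  exact ⟨t', ht', hle⟩

/-! ### The capacity of the whole space -/

/-- The uniform measure on a unit segment has finite energy, as the logarithm is integrable. -/
lemma lintegral_posKernel_segment_ne_top :
    ∫⁻ x in Set.Icc (0 : ℝ) 1, ∫⁻ y in Set.Icc (0 : ℝ) 1, posKernel x y ≠ ⊤ := by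
  set I : ℝ≥0∞ := ∫⁻ u in Set.Icc (-1 : ℝ) 1, ENNReal.ofReal (-Real.log u) with hI
  have hItop : I ≠ ⊤ := by
    have h1 : IntegrableOn Real.log (Set.Icc (-1) 1) := by
      rw [← intervalIntegrable_iff_integrableOn_Icc_of_le (by norm_num)]
      exact intervalIntegral.intervalIntegrable_log'
    exact h1.neg.lintegral_lt_top.ne
  refine ne_top_of_le_ne_top (b := ∫⁻ _ in Set.Icc (0 : ℝ) 1, I) ?_ ?_
  · simpa using hItop
  refine setLIntegral_mono' measurableSet_Icc fun x hx => ?_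
  have hae : ∀ᵐ y : ℝ ∂(volume.restrict (Set.Icc (0 : ℝ) 1)),
      posKernel x y = ENNReal.ofReal (-Real.log (y - x)) := by
    refine ae_restrict_of_ae ?_
    have : ∀ᵐ y : ℝ, y ≠ x := by rw [ae_iff]; simp
    filter_upwards [this] with y hy
    rw [posKernel_of_ne (by exact_mod_cast hy.symm), Complex.dist_eq, ← Complex.ofReal_sub,
      Complex.norm_real, Real.norm_eq_abs, Real.log_abs, ← Real.log_neg_eq_log, neg_sub]
  rw [lintegral_congr_ae hae]
  calc ∫⁻ y in Set.Icc (0 : ℝ) 1, ENNReal.ofReal (-Real.log (y - x))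
      = ∫⁻ y, (Set.Icc (0 : ℝ) 1).indicator (fun y => ENNReal.ofReal (-Real.log (y - x))) y :=
        (lintegral_indicator measurableSet_Icc _).symm
    _ ≤ ∫⁻ y, (Set.Icc (-1 : ℝ) 1).indicator (fun u => ENNReal.ofReal (-Real.log u)) (y - x) := by
        refine lintegral_mono fun y => ?_
        by_cases hy : y ∈ Set.Icc (0 : ℝ) 1
        · have hyx : y - x ∈ Set.Icc (-1 : ℝ) 1 :=
            ⟨by linarith [hx.2, hy.1], by linarith [hx.1, hy.2]⟩
          rw [Set.indicator_of_mem hy, Set.indicator_of_mem hyx]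
        · rw [Set.indicator_of_notMem hy]
          exact zero_le
    _ = I := by
        rw [lintegral_sub_right_eq_self (fun u => (Set.Icc (-1 : ℝ) 1).indicator
          (fun u => ENNReal.ofReal (-Real.log u)) u), lintegral_indicator measurableSet_Icc]

lemma logCapacity_univ_pos : 0 < logCapacity Set.univ := by
  have hp : IsProbabilityMeasure (volume.restrict (Set.Icc (0 : ℝ) 1)) := ⟨by simp⟩
  have hmeas : Measurable ((↑) : ℝ → ℂ) := Complex.measurable_ofReal
  have hμ := Measure.isProbabilityMeasure_map (μ := volume.restrict (Set.Icc (0 : ℝ) 1))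
    hmeas.aemeasurable
  set μ : Measure ℂ := Measure.map ((↑) : ℝ → ℂ) (volume.restrict (Set.Icc (0 : ℝ) 1)) with hμdef
  have hK : IsCompact (((↑) : ℝ → ℂ) '' Set.Icc (0 : ℝ) 1) :=
    isCompact_Icc.image Complex.continuous_ofReal
  have hE : logEnergy μ ≠ ⊤ := by
    have h1 : ∫⁻ z, ∫⁻ w, posKernel z w ∂μ ∂μ ≠ ⊤ := by
      rw [hμdef, lintegral_map (by exact measurable_posKernel.lintegral_prod_right') hmeas]
      simp_rw [lintegral_map (measurable_posKernel_right _) hmeas]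
      exact lintegral_posKernel_segment_ne_top
    rw [logEnergy_eq, sub_eq_add_neg]
    refine (EReal.add_lt_top (by simpa using h1) ?_).ne
    simp
  refine lt_of_lt_of_le ?_ (le_iSup₂_of_le (⟨μ, hμ⟩ : ProbabilityMeasure ℂ)
    ⟨_, Set.subset_univ _, hK, ?_⟩ le_rfl)
  · rw [pos_iff_ne_zero, ne_eq, EReal.exp_eq_zero_iff]
    simpa using hE
  · change μ _ = 0
    rw [hμdef, Measure.map_apply hmeas hK.measurableSet.compl,
      Measure.restrict_apply (hmeas hK.measurableSet.compl)]
    convert measure_empty (μ := (volume : Measure ℝ))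
    exact Set.eq_empty_of_forall_notMem fun x hx => hx.1 ⟨x, hx.2, rfl⟩

lemma gammaProjToLine_univ : ∀ m : ℕ, 1 ≤ m →
    gammaProjToLine m (Set.univ : Set (Fin m → ℂ)) = Set.univ
  | 0, h => by omega
  | 1, _ => by simp [gammaProjToLine]
  | m + 2, _ => by
    have : gammaProj (Set.univ : Set (Fin (m + 2) → ℂ)) = Set.univ := by
      ext z; simpa [gammaProj] using logCapacity_univ_pos
    rw [gammaProjToLine, this, gammaProjToLine_univ (m + 1) (by omega)]

lemma gammaCapacity_univ_ne_zero {m : ℕ} (hm : 1 ≤ m) :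
    gammaCapacity (Set.univ : Set (Fin m → ℂ)) ≠ 0 := by
  rw [← pos_iff_ne_zero]
  refine lt_of_lt_of_le logCapacity_univ_pos (le_iSup_of_le 1 ?_)
  simp [gammaProjToLine_univ m hm]

/-! ### Convergent power series in several variables -/

variable {n : ℕ}

/-- The term `c_α z^α` of a formal power series at the point `z`. -/
noncomputable def seriesTerm (a : MvPowerSeries (Fin n) ℂ) (z : Fin n → ℂ) (α : Fin n →₀ ℕ) : ℂ :=
  MvPowerSeries.coeff α a * ∏ k, z k ^ α k

/-- The series `a` sums to `v` at `z`, and the sum of the absolute values of its terms is at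
most `B`. -/
structure HasAbsSum (a : MvPowerSeries (Fin n) ℂ) (z : Fin n → ℂ) (v : ℂ) (B : ℝ) : Prop where
  hasSum : HasSum (seriesTerm a z) v
  summable : Summable fun α => ‖seriesTerm a z α‖
  tsum_le : ∑' α, ‖seriesTerm a z α‖ ≤ B

lemma HasAbsSum.norm_le {a : MvPowerSeries (Fin n) ℂ} {z : Fin n → ℂ} {v : ℂ} {B : ℝ}
    (h : HasAbsSum a z v B) : ‖v‖ ≤ B := by
  rw [← h.hasSum.tsum_eq]
  exact (norm_tsum_le_tsum_norm h.summable).trans h.tsum_le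

lemma seriesTerm_mul (a b : MvPowerSeries (Fin n) ℂ) (z : Fin n → ℂ) (α : Fin n →₀ ℕ) :
    seriesTerm (a * b) z α =
      ∑ x ∈ Finset.HasAntidiagonal.antidiagonal α, seriesTerm a z x.1 * seriesTerm b z x.2 := by
  rw [seriesTerm, MvPowerSeries.coeff_mul, Finset.sum_mul]
  refine Finset.sum_congr rfl fun x hx => ?_
  rw [← Finset.HasAntidiagonal.mem_antidiagonal.1 hx]
  simp only [seriesTerm, Finsupp.add_apply, pow_add, Finset.prod_mul_distrib]
  ring

lemma HasAbsSum.mul {a b : MvPowerSeries (Fin n) ℂ} {z : Fin n → ℂ} {u v : ℂ} {A B : ℝ}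
    (ha : HasAbsSum a z u A) (hb : HasAbsSum b z v B) : HasAbsSum (a * b) z (u * v) (A * B) := by
  have heq : seriesTerm (a * b) z = fun α =>
      ∑ x ∈ Finset.HasAntidiagonal.antidiagonal α, seriesTerm a z x.1 * seriesTerm b z x.2 :=
    funext (seriesTerm_mul a b z)
  have hs' : Summable fun α => ∑ x ∈ Finset.HasAntidiagonal.antidiagonal α,
      ‖seriesTerm a z x.1‖ * ‖seriesTerm b z x.2‖ :=
    summable_sum_mul_antidiagonal_of_summable_mul (f := fun α => ‖seriesTerm a z α‖)
      (g := fun α => ‖seriesTerm b z α‖)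
      (ha.summable.mul_of_nonneg hb.summable (fun _ => norm_nonneg _) fun _ => norm_nonneg _)
  have hle : ∀ α, ‖∑ x ∈ Finset.HasAntidiagonal.antidiagonal α,
      seriesTerm a z x.1 * seriesTerm b z x.2‖ ≤ ∑ x ∈ Finset.HasAntidiagonal.antidiagonal α,
        ‖seriesTerm a z x.1‖ * ‖seriesTerm b z x.2‖ := fun α =>
    (norm_sum_le _ _).trans (Finset.sum_le_sum fun x _ => norm_mul_le _ _)
  have hs := Summable.of_nonneg_of_le (fun _ => norm_nonneg _) hle hs'
  refine ⟨?_, by rw [heq]; exact hs, ?_⟩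
  · rw [heq, ← ha.hasSum.tsum_eq, ← hb.hasSum.tsum_eq,
      ha.hasSum.summable.tsum_mul_tsum_eq_tsum_sum_antidiagonal hb.hasSum.summable
        (summable_mul_of_summable_norm ha.summable hb.summable)]
    exact hs.of_norm.hasSum
  · rw [heq]
    calc ∑' α, ‖∑ x ∈ Finset.HasAntidiagonal.antidiagonal α, seriesTerm a z x.1 * seriesTerm b z x.2‖
        ≤ ∑' α, ∑ x ∈ Finset.HasAntidiagonal.antidiagonal α, ‖seriesTerm a z x.1‖ * ‖seriesTerm b z x.2‖ :=
          hs.tsum_le_tsum hle hs'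
      _ = (∑' α, ‖seriesTerm a z α‖) * ∑' α, ‖seriesTerm b z α‖ :=
          (Summable.tsum_mul_tsum_eq_tsum_sum_antidiagonal ha.summable hb.summable
            (ha.summable.mul_of_nonneg hb.summable (fun _ => norm_nonneg _)
              fun _ => norm_nonneg _)).symm
      _ ≤ A * B := by
          have hA : 0 ≤ A := (norm_nonneg u).trans ha.norm_le
          exact mul_le_mul ha.tsum_le hb.tsum_le (tsum_nonneg fun _ => norm_nonneg _) hA

lemma hasAbsSum_one (z : Fin n → ℂ) : HasAbsSum 1 z 1 1 := by
  have h0 : seriesTerm (1 : MvPowerSeries (Fin n) ℂ) z = fun α => if α = 0 then 1 else 0 := by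
    funext α
    rw [seriesTerm, MvPowerSeries.coeff_one]
    split_ifs with h <;> simp [h]
  have h1 : (fun α => ‖seriesTerm (1 : MvPowerSeries (Fin n) ℂ) z α‖) =
      fun α => if α = 0 then (1 : ℝ) else 0 := by
    funext α
    simp only [h0]
    split_ifs <;> simp
  refine ⟨?_, ?_, ?_⟩
  · rw [h0]; exact hasSum_ite_eq 0 1
  · rw [h1]; exact (hasSum_ite_eq 0 1).summable
  · rw [h1, (hasSum_ite_eq 0 (1 : ℝ)).tsum_eq]

lemma HasAbsSum.pow {a : MvPowerSeries (Fin n) ℂ} {z : Fin n → ℂ} {v : ℂ} {B : ℝ}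
    (h : HasAbsSum a z v B) (m : ℕ) : HasAbsSum (a ^ m) z (v ^ m) (B ^ m) := by
  induction m with
  | zero => simpa using hasAbsSum_one z
  | succ m ih => simpa only [pow_succ] using ih.mul h

lemma hasAbsSum_prod {ι : Type*} (s : Finset ι) {a : ι → MvPowerSeries (Fin n) ℂ} {z : Fin n → ℂ}
    {v : ι → ℂ} {B : ι → ℝ} (h : ∀ i ∈ s, HasAbsSum (a i) z (v i) (B i)) :
    HasAbsSum (∏ i ∈ s, a i) z (∏ i ∈ s, v i) (∏ i ∈ s, B i) := by
  classical
  induction s using Finset.induction_on with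
  | empty => simpa using hasAbsSum_one z
  | insert i s hi ih =>
    simp only [Finset.prod_insert hi]
    exact (h i (Finset.mem_insert_self i s)).mul
      (ih fun j hj => h j (Finset.mem_insert_of_mem hj))

lemma norm_seriesTerm (a : MvPowerSeries (Fin n) ℂ) (z : Fin n → ℂ) (α : Fin n →₀ ℕ) :
    ‖seriesTerm a z α‖ = ‖MvPowerSeries.coeff α a‖ * ∏ k, ‖z k‖ ^ α k := by
  simp [seriesTerm]

lemma prod_const_pow (r : ℝ) (α : Fin n →₀ ℕ) : ∏ k, r ^ α k = r ^ α.degree := by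
  rw [Finset.prod_pow_eq_pow_sum, Finsupp.degree_eq_sum]

lemma norm_seriesTerm_const (a : MvPowerSeries (Fin n) ℂ) {r : ℝ} (hr : 0 ≤ r)
    (α : Fin n →₀ ℕ) :
    ‖seriesTerm a (fun _ => (r : ℂ)) α‖ = ‖MvPowerSeries.coeff α a‖ * r ^ α.degree := by
  rw [norm_seriesTerm, ← prod_const_pow]
  simp [abs_of_nonneg hr]

lemma norm_seriesTerm_le (a : MvPowerSeries (Fin n) ℂ) {z : Fin n → ℂ} {r : ℝ} (hz : ‖z‖ ≤ r)
    (α : Fin n →₀ ℕ) : ‖seriesTerm a z α‖ ≤ ‖MvPowerSeries.coeff α a‖ * r ^ α.degree := by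
  rw [norm_seriesTerm, ← prod_const_pow]
  gcongr with k
  exact (norm_le_pi_norm z k).trans hz

/-- A convergent series without constant term is small near the origin, in the sense of absolute
values of its terms. -/
lemma eventually_hasAbsSum {a : MvPowerSeries (Fin n) ℂ}
    (h0 : MvPowerSeries.constantCoeff a = 0) {g : (Fin n → ℂ) → ℂ}
    (hg : ∀ᶠ z in 𝓝 0, HasSum (seriesTerm a z) (g z)) {ε : ℝ} (hε : 0 < ε) :
    ∀ᶠ z in 𝓝 0, HasAbsSum a z (g z) ε := by
  obtain ⟨δ, hδ, hball⟩ := Metric.eventually_nhds_iff_ball.1 hg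
  set r : ℝ := δ / 2 with hr
  have hrpos : 0 < r := by positivity
  have hmem : (fun _ => (r : ℂ) : Fin n → ℂ) ∈ Metric.ball (0 : Fin n → ℂ) δ := by
    rw [mem_ball_zero_iff, pi_norm_lt_iff hδ]
    intro k
    rw [Complex.norm_real, Real.norm_of_nonneg hrpos.le]
    linarith
  have hsum : Summable fun α : Fin n →₀ ℕ => ‖MvPowerSeries.coeff α a‖ * r ^ α.degree := by
    have := (hball _ hmem).summable.norm
    simpa only [norm_seriesTerm_const a hrpos.le] using this
  set b := ∑' α : Fin n →₀ ℕ, ‖MvPowerSeries.coeff α a‖ * r ^ α.degree with hb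
  have hb0 : 0 ≤ b := tsum_nonneg fun _ => by positivity
  set s : ℝ := min 1 (ε / (b + 1)) with hs
  have hspos : 0 < s := by positivity
  have hsb : s * b ≤ ε := by
    calc s * b ≤ ε / (b + 1) * (b + 1) := by
          gcongr
          · exact min_le_right _ _
          · linarith
      _ = ε := by field_simp
  have hnhds : Metric.ball (0 : Fin n → ℂ) (s * r) ∈ 𝓝 0 := Metric.ball_mem_nhds _ (by positivity)
  filter_upwards [hg, hnhds] with z hz hzball
  have hle : ∀ α, ‖seriesTerm a z α‖ ≤ s * (‖MvPowerSeries.coeff α a‖ * r ^ α.degree) := by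
    intro α
    refine (norm_seriesTerm_le a (mem_ball_zero_iff.1 hzball).le α).trans ?_
    rcases Nat.eq_zero_or_pos α.degree with h | h
    · rw [(Finsupp.degree_eq_zero_iff α).1 h, MvPowerSeries.coeff_zero_eq_constantCoeff_apply, h0]
      simp
    · rw [mul_pow]
      have : s ^ α.degree ≤ s := pow_le_of_le_one hspos.le (min_le_left _ _) (by omega)
      calc _ = s ^ α.degree * (‖MvPowerSeries.coeff α a‖ * r ^ α.degree) := by ring
        _ ≤ _ := by gcongr
  have hsm : Summable fun α => ‖seriesTerm a z α‖ :=
    Summable.of_nonneg_of_le (fun _ => norm_nonneg _) hle (hsum.mul_left s)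
  refine ⟨hz, hsm, ?_⟩
  exact (hsm.tsum_le_tsum hle (hsum.mul_left s)).trans (by rw [tsum_mul_left]; exact hsb)

lemma hasSum_coeff_subst {φ : FormalMap n} (hφ : MvPowerSeries.HasSubst φ)
    (a : MvPowerSeries (Fin n) ℂ) (e : Fin n →₀ ℕ) :
    HasSum (fun d => MvPowerSeries.coeff d a *
      MvPowerSeries.coeff e (d.prod fun s e => φ s ^ e))
      (MvPowerSeries.coeff e (MvPowerSeries.subst φ a)) := by
  have hfin := MvPowerSeries.coeff_subst_finite hφ a e
  rw [MvPowerSeries.coeff_subst hφ, ← tsum_eq_finsum (L := .unconditional _) hfin]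
  exact (summable_of_hasFiniteSupport hfin).hasSum

/-- The substitution of convergent series without constant term into a convergent series
converges to the composition of the sums. -/
lemma eventually_hasSum_subst {a : MvPowerSeries (Fin n) ℂ} {φ : FormalMap n}
    {G : (Fin n → ℂ) → ℂ} {g : (Fin n → ℂ) → (Fin n → ℂ)}
    (hφ0 : ∀ j, MvPowerSeries.constantCoeff (φ j) = 0)
    (hG : ∀ᶠ z in 𝓝 0, HasSum (seriesTerm a z) (G z)) (hg : HasExpansion g φ) :
    ∀ᶠ z in 𝓝 0, HasSum (seriesTerm (MvPowerSeries.subst φ a) z) (G (g z)) := by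
  obtain ⟨δ, hδ, hball⟩ := Metric.eventually_nhds_iff_ball.1 hG
  set ρ : ℝ := δ / 2 with hρ
  have hρpos : 0 < ρ := by positivity
  have hmem : ∀ y : Fin n → ℂ, ‖y‖ ≤ ρ → y ∈ Metric.ball (0 : Fin n → ℂ) δ := by
    intro y hy
    rw [mem_ball_zero_iff]
    linarith
  have hsum : Summable fun α : Fin n →₀ ℕ => ‖MvPowerSeries.coeff α a‖ * ρ ^ α.degree := by
    have h1 : ‖(fun _ => (ρ : ℂ) : Fin n → ℂ)‖ ≤ ρ := by
      rw [pi_norm_le_iff_of_nonneg hρpos.le]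
      intro k
      rw [Complex.norm_real, Real.norm_of_nonneg hρpos.le]
    have := (hball _ (hmem _ h1)).summable.norm
    simpa only [norm_seriesTerm_const a hρpos.le] using this
  have hsub : MvPowerSeries.HasSubst φ := MvPowerSeries.hasSubst_of_constantCoeff_zero hφ0
  have hall : ∀ᶠ z in 𝓝 0, ∀ j, HasAbsSum (φ j) z (g z j) ρ := by
    rw [eventually_all]
    exact fun j => eventually_hasAbsSum (hφ0 j) (hg.mono fun z hz => hz j) hρpos
  filter_upwards [hall] with z hz
  have hgz : ‖g z‖ ≤ ρ := (pi_norm_le_iff_of_nonneg hρpos.le).2 fun j => (hz j).norm_le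
  have hprod : ∀ d : Fin n →₀ ℕ, HasAbsSum (d.prod fun s e => φ s ^ e) z
      (∏ k, g z k ^ d k) (ρ ^ d.degree) := by
    intro d
    rw [Finsupp.prod_fintype _ _ (fun _ => pow_zero _), ← prod_const_pow]
    exact hasAbsSum_prod _ fun k _ => (hz k).pow (d k)
  set F : (Fin n →₀ ℕ) × (Fin n →₀ ℕ) → ℂ := fun x =>
    MvPowerSeries.coeff x.1 a * seriesTerm (x.1.prod fun s e => φ s ^ e) z x.2 with hF
  have hFs : Summable F := by
    refine Summable.of_norm ?_
    rw [summable_prod_of_nonneg fun _ => norm_nonneg _]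
    constructor
    · intro d
      simpa only [hF, norm_mul] using (hprod d).summable.mul_left _
    · refine Summable.of_nonneg_of_le (fun _ => tsum_nonneg fun _ => norm_nonneg _) (fun d => ?_)
        hsum
      simp only [hF, norm_mul, tsum_mul_left]
      exact mul_le_mul_of_nonneg_left (hprod d).tsum_le (norm_nonneg _)
  obtain ⟨S, hS⟩ := hFs
  -- summing first over the monomials of `φ ^ d` gives `G (g z)`
  have h1 : ∀ d, HasSum (fun e => F (d, e)) (seriesTerm a (g z) d) := fun d => by
    simp only [hF]
    exact (hprod d).hasSum.mul_left _
  rw [(hball _ (hmem _ hgz)).unique (hS.prod_fiberwise h1)]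
  -- summing first over `d` gives the coefficients of the substituted series
  have h2 : ∀ e, HasSum (fun d => F (d, e)) (seriesTerm (MvPowerSeries.subst φ a) z e) := fun e => by
    have h3 := (hasSum_coeff_subst hsub a e).mul_right (∏ k, z k ^ e k)
    simp only [mul_assoc] at h3
    exact h3
  have hS' : HasSum (fun x : (Fin n →₀ ℕ) × (Fin n →₀ ℕ) => F (x.2, x.1)) S :=
    (Equiv.prodComm _ _).hasSum_iff.2 hS
  exact hS'.prod_fiberwise h2

/-- The monomial `z^α` of degree `N` is the restriction to the diagonal of an `N`-linear form of
norm at most `1`. -/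
lemma exists_multilinear_monomial {N : ℕ} (α : Fin n →₀ ℕ) (hα : α.degree = N) :
    ∃ M : ContinuousMultilinearMap ℂ (fun _ : Fin N => Fin n → ℂ) ℂ,
      ‖M‖ ≤ 1 ∧ ∀ z, M (fun _ => z) = ∏ k, z k ^ α k := by
  obtain ⟨L, hL⟩ := Quot.exists_rep α.toMultiset
  have hL' : (L : Multiset (Fin n)) = α.toMultiset := hL
  have hlen : L.length = N := by
    rw [← hα, ← Multiset.coe_card, hL', Finsupp.card_toMultiset, Finsupp.degree_eq_sum,
      Finsupp.sum_fintype _ _ (fun _ => rfl)]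
    rfl
  subst hlen
  refine ⟨(ContinuousMultilinearMap.mkPiAlgebra ℂ (Fin L.length) ℂ).compContinuousLinearMap
    fun i => ContinuousLinearMap.proj (L.get i), ?_, fun z => ?_⟩
  · refine ContinuousMultilinearMap.opNorm_le_bound zero_le_one fun v => ?_
    simp only [ContinuousMultilinearMap.compContinuousLinearMap_apply,
      ContinuousMultilinearMap.mkPiAlgebra_apply, ContinuousLinearMap.proj_apply, norm_prod,
      one_mul]
    exact Finset.prod_le_prod (fun _ _ => norm_nonneg _) fun i _ => norm_le_pi_norm (v i) _
  · simp only [ContinuousMultilinearMap.compContinuousLinearMap_apply,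
      ContinuousMultilinearMap.mkPiAlgebra_apply, ContinuousLinearMap.proj_apply]
    rw [← Finsupp.prod_fintype _ _ (fun _ => pow_zero _)]
    have h1 : (α.toMultiset.map z).prod = α.prod fun k e => z k ^ e := by
      rw [Finsupp.toMultiset_map, Finsupp.prod_toMultiset, Finsupp.prod_mapDomain_index] <;>
        simp [pow_add]
    rw [← h1, ← hL', Multiset.map_coe, Multiset.prod_coe]
    simp

/-- The sum of a convergent power series is analytic at the origin, and its derivative there is
given by the coefficients of degree one. -/
lemma analyticAt_and_hasFDerivAt {a : MvPowerSeries (Fin n) ℂ} {G : (Fin n → ℂ) → ℂ}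
    (hG : ∀ᶠ z in 𝓝 0, HasSum (seriesTerm a z) (G z)) :
    AnalyticAt ℂ G 0 ∧ ∃ L : (Fin n → ℂ) →L[ℂ] ℂ, HasFDerivAt G L 0 ∧
      ∀ k, L (Pi.single k 1) = MvPowerSeries.coeff (Finsupp.single k 1) a := by
  classical
  obtain ⟨δ, hδ, hball⟩ := Metric.eventually_nhds_iff_ball.1 hG
  obtain ⟨r, hr⟩ : ∃ r : NNReal, (r : ℝ) = δ / 2 := ⟨⟨δ / 2, by positivity⟩, rfl⟩
  have hrpos : (0 : ℝ) < r := by rw [hr]; positivity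
  have hmem : ∀ y : Fin n → ℂ, ‖y‖ ≤ r → y ∈ Metric.ball (0 : Fin n → ℂ) δ := by
    intro y hy
    rw [mem_ball_zero_iff]
    linarith
  have hsum : Summable fun α : Fin n →₀ ℕ => ‖MvPowerSeries.coeff α a‖ * (r : ℝ) ^ α.degree := by
    have h1 : ‖(fun _ => ((r : ℝ) : ℂ) : Fin n → ℂ)‖ ≤ r := by
      rw [pi_norm_le_iff_of_nonneg hrpos.le]
      intro k
      rw [Complex.norm_real, Real.norm_of_nonneg hrpos.le]
    have := (hball _ (hmem _ h1)).summable.norm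
    simpa only [norm_seriesTerm_const a hrpos.le] using this
  have hfin : ∀ N : ℕ, Finite {α : Fin n →₀ ℕ // α.degree = N} := fun N =>
    ((Finsupp.finite_of_degree_le N).subset fun α hα => le_of_eq hα).to_subtype
  have hft : ∀ N : ℕ, Fintype {α : Fin n →₀ ℕ // α.degree = N} := fun N => Fintype.ofFinite _
  choose M hM1 hM using fun (N : ℕ) (α : {α : Fin n →₀ ℕ // α.degree = N}) =>
    exists_multilinear_monomial α.1 α.2
  set p : FormalMultilinearSeries ℂ (Fin n → ℂ) ℂ := fun N =>
    ∑ α : {α : Fin n →₀ ℕ // α.degree = N}, MvPowerSeries.coeff α.1 a • M N α with hp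
  have hpapp : ∀ N z, p N (fun _ => z) =
      ∑ α : {α : Fin n →₀ ℕ // α.degree = N}, seriesTerm a z α.1 := by
    intro N z
    simp only [hp, _root_.sum_apply, _root_.smul_apply, hM,
      smul_eq_mul, seriesTerm]
  have hps : HasFPowerSeriesOnBall G p 0 r := by
    refine ⟨?_, by exact_mod_cast hrpos, fun {y} hy => ?_⟩
    · refine p.le_radius_of_bound (∑' α : Fin n →₀ ℕ, ‖MvPowerSeries.coeff α a‖ * (r : ℝ) ^ α.degree)
        fun N => ?_
      calc ‖p N‖ * (r : ℝ) ^ N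
          ≤ (∑ α : {α : Fin n →₀ ℕ // α.degree = N}, ‖MvPowerSeries.coeff α.1 a‖) * (r : ℝ) ^ N := by
            gcongr
            refine (norm_sum_le _ _).trans (Finset.sum_le_sum fun α _ => ?_)
            rw [norm_smul]
            exact mul_le_of_le_one_right (norm_nonneg _) (hM1 N α)
        _ = ∑ α : {α : Fin n →₀ ℕ // α.degree = N},
              ‖MvPowerSeries.coeff α.1 a‖ * (r : ℝ) ^ α.1.degree := by
            rw [Finset.sum_mul]
            exact Finset.sum_congr rfl fun α _ => by rw [α.2]
        _ = ∑' α : {α : Fin n →₀ ℕ // α.degree = N},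
              ‖MvPowerSeries.coeff α.1 a‖ * (r : ℝ) ^ α.1.degree := (tsum_fintype _).symm
        _ ≤ _ := hsum.tsum_subtype_le _ {α | α.degree = N} (fun _ => by positivity)
    · rw [zero_add]
      have hy' : ‖y‖ ≤ r := by
        rw [Metric.eball_coe, mem_ball_zero_iff] at hy
        exact hy.le
      have h1 := hball y (hmem y hy')
      have h2 := (Equiv.sigmaFiberEquiv (fun α : Fin n →₀ ℕ => α.degree)).hasSum_iff.2 h1
      refine h2.sigma fun N => ?_
      rw [hpapp]
      exact hasSum_fintype _
  refine ⟨hps.analyticAt, _, hps.hasFPowerSeriesAt.hasFDerivAt, fun k => ?_⟩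
  rw [continuousMultilinearCurryFin1_apply]
  have hconst : (Fin.snoc 0 (Pi.single k 1 : Fin n → ℂ) : Fin 1 → Fin n → ℂ) =
      fun _ => Pi.single k 1 := by
    funext i; fin_cases i; rfl
  rw [hconst, hpapp, Fintype.sum_eq_single ⟨Finsupp.single k 1, by simp⟩]
  · rw [seriesTerm, Finset.prod_eq_one, mul_one]
    intro i _
    by_cases hik : i = k
    · subst hik; simp
    · simp [Ne.symm hik]
  · rintro ⟨α, hα⟩ hne
    have : ∃ i, i ≠ k ∧ α i ≠ 0 := by
      by_contra! hno
      apply hne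
      have h1 : α.degree = α k := by
        rw [Finsupp.degree_eq_sum]
        exact Finset.sum_eq_single_of_mem k (Finset.mem_univ _) fun i _ hi => hno i hi
      refine Subtype.ext (Finsupp.ext fun i => ?_)
      by_cases hik : i = k
      · subst hik; simp [← hα, h1]
      · rw [hno i hik]; simp [Ne.symm hik]
    obtain ⟨i, hik, hi⟩ := this
    rw [seriesTerm, Finset.prod_eq_zero (Finset.mem_univ i), mul_zero]
    rw [Pi.single_eq_of_ne hik, zero_pow hi]

/-! ### Convergent linearizations and the growth of coefficients -/

lemma seriesTerm_zero_hasSum (a : MvPowerSeries (Fin n) ℂ) :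
    HasSum (seriesTerm a 0) (MvPowerSeries.constantCoeff a) := by
  have h : seriesTerm a 0 0 = MvPowerSeries.constantCoeff a := by
    simp [seriesTerm]
  rw [← h]
  refine hasSum_single 0 fun α hα => ?_
  obtain ⟨k, hk⟩ := Finsupp.ne_iff.1 hα
  rw [seriesTerm, Finset.prod_eq_zero (Finset.mem_univ k), mul_zero]
  exact zero_pow hk

/-- A convergent formal linearization of a germ fixing the origin linearizes it holomorphically:
it is the Taylor series of a local diffeomorphism, and the formal conjugacy equation can be
summed. -/
lemma IsFormalLinearization.holomorphicallyLinearizes {A : Matrix (Fin n) (Fin n) ℂ}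
    {g : (Fin n → ℂ) → (Fin n → ℂ)} {h : FormalMap n} (hlin : IsFormalLinearization A g h)
    (hg0 : g 0 = 0) (hconv : h.Converges) : HolomorphicallyLinearizes A g h := by
  obtain ⟨h0, hunit, φ, hφ, hconj⟩ := hlin
  set H : (Fin n → ℂ) → (Fin n → ℂ) := fun z j => ∑' α, seriesTerm (h j) z α with hH
  have hexp : ∀ᶠ z in 𝓝 0, ∀ j, HasSum (seriesTerm (h j) z) (H z j) :=
    hconv.mono fun z hz j => (hz j).hasSum
  have hexpj : ∀ j, ∀ᶠ z in 𝓝 0, HasSum (seriesTerm (h j) z) (H z j) :=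
    fun j => hexp.mono fun z hz => hz j
  have hφ0 : ∀ j, MvPowerSeries.constantCoeff (φ j) = 0 := fun j => by
    have h1 : HasSum (seriesTerm (φ j) 0) (g 0 j) := hφ.self_of_nhds j
    rw [(seriesTerm_zero_hasSum (φ j)).unique h1, hg0]
    rfl
  choose han L hL hLc using fun j => analyticAt_and_hasFDerivAt (hexpj j)
  refine ⟨H, hexp, analyticAt_pi_iff.2 han, ?_, ?_, ?_⟩
  · funext j
    have h1 : HasSum (seriesTerm (h j) 0) (H 0 j) := hexp.self_of_nhds j
    rw [← (seriesTerm_zero_hasSum (h j)).unique h1, h0 j]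
    rfl
  · have hder : HasFDerivAt H (ContinuousLinearMap.pi L) 0 := hasFDerivAt_pi.2 hL
    have hLeq : ContinuousLinearMap.pi L = LinearMap.toContinuousLinearMap
        (Matrix.toLin' h.linearPart) := by
      refine ContinuousLinearMap.coe_injective (LinearMap.pi_ext' fun k => ?_)
      ext j
      simp [hLc, FormalMap.linearPart]
    rw [hder.fderiv, hLeq]
    have hdet : IsUnit h.linearPart.det := (Matrix.isUnit_iff_isUnit_det _).1 hunit
    refine ContinuousLinearMap.IsInvertible.of_inverse
      (g := LinearMap.toContinuousLinearMap (Matrix.toLin' h.linearPart⁻¹)) ?_ ?_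
    · ext1 v
      simp [Matrix.mulVec_mulVec, Matrix.mul_nonsing_inv _ hdet]
    · ext1 v
      simp [Matrix.mulVec_mulVec, Matrix.nonsing_inv_mul _ hdet]
  · have hcomp : ∀ᶠ z in 𝓝 0, ∀ j,
        HasSum (seriesTerm (MvPowerSeries.subst φ (h j)) z) (H (g z) j) :=
      eventually_all.2 fun j => eventually_hasSum_subst (G := fun z => H z j) hφ0 (hexpj j) hφ
    filter_upwards [hcomp, hexp] with z hz hz'
    funext j
    refine (hz j).unique ?_
    have h1 := hasSum_sum (s := Finset.univ) fun k _ => (hz' k).mul_left (A j k)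
    have h2 : seriesTerm (MvPowerSeries.subst φ (h j)) z =
        fun α => ∑ k, A j k * seriesTerm (h k) z α := by
      funext α
      simp [hconj j, seriesTerm, Finset.sum_mul, mul_assoc]
    rw [h2]
    exact h1

lemma summable_prod_pow {x : ℝ} (h0 : 0 ≤ x) (h1 : x < 1) :
    ∀ n : ℕ, Summable fun α : Fin n → ℕ => ∏ k, x ^ α k
  | 0 => (hasSum_fintype _).summable
  | n + 1 => by
    have h := (summable_geometric_of_lt_one h0 h1).mul_of_nonneg (summable_prod_pow h0 h1 n)
      (fun _ => pow_nonneg h0 _) fun _ => Finset.prod_nonneg fun _ _ => pow_nonneg h0 _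
    rw [← (Fin.consEquiv fun _ : Fin (n + 1) => ℕ).summable_iff]
    refine h.congr fun y => ?_
    simp [Fin.prod_univ_succ, Fin.consEquiv]

lemma summable_pow_degree {x : ℝ} (h0 : 0 ≤ x) (h1 : x < 1) :
    Summable fun α : Fin n →₀ ℕ => x ^ α.degree := by
  have h := (Finsupp.equivFunOnFinite (α := Fin n) (M := ℕ)).summable_iff.2
    (summable_prod_pow h0 h1 n)
  refine h.congr fun α => ?_
  simp [← prod_const_pow]

/-- Exponential bounds on the coefficients imply convergence. -/
lemma FormalMap.converges_of_norm_coeff_le {h : FormalMap n} {a b : ℝ} (hb : 0 ≤ b)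
    (hle : ∀ j α, ‖MvPowerSeries.coeff α (h j)‖ ≤ a * b ^ α.degree) : h.Converges := by
  have hr : 0 < 1 / (2 * (b + 1)) := by positivity
  filter_upwards [Metric.ball_mem_nhds (0 : Fin n → ℂ) hr] with z hz j
  have hsum := (summable_pow_degree (n := n) (x := 1 / 2) (by norm_num) (by norm_num)).mul_left |a|
  refine Summable.of_norm_bounded hsum fun α => ?_
  refine (norm_seriesTerm_le (h j) (mem_ball_zero_iff.1 hz).le α).trans ?_
  calc ‖MvPowerSeries.coeff α (h j)‖ * (1 / (2 * (b + 1))) ^ α.degree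
      ≤ (|a| * b ^ α.degree) * (1 / (2 * (b + 1))) ^ α.degree := by
        gcongr
        exact (hle j α).trans (by gcongr; exact le_abs_self a)
    _ = |a| * (b * (1 / (2 * (b + 1)))) ^ α.degree := by rw [mul_pow, mul_assoc]
    _ ≤ |a| * (1 / 2) ^ α.degree := by
        gcongr
        rw [mul_one_div, div_le_div_iff₀ (by positivity) (by norm_num)]
        linarith

/-- The coefficients of a convergent formal map without constant term are bounded by powers of
a constant. -/
lemma FormalMap.Converges.exists_norm_coeff_le {h : FormalMap n} (hconv : h.Converges)
    (h0 : ∀ j, MvPowerSeries.constantCoeff (h j) = 0) :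
    ∃ b : ℝ, ∀ j α, ‖MvPowerSeries.coeff α (h j)‖ ≤ b ^ α.degree := by
  obtain ⟨δ, hδ, hball⟩ := Metric.eventually_nhds_iff_ball.1 hconv
  set r : ℝ := δ / 2 with hr
  have hrpos : 0 < r := by positivity
  have hmem : (fun _ => (r : ℂ) : Fin n → ℂ) ∈ Metric.ball (0 : Fin n → ℂ) δ := by
    rw [mem_ball_zero_iff, pi_norm_lt_iff hδ]
    intro k
    rw [Complex.norm_real, Real.norm_of_nonneg hrpos.le]
    linarith
  have hsum : ∀ j, Summable fun α => ‖seriesTerm (h j) (fun _ => (r : ℂ)) α‖ := fun j =>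
    (hball _ hmem j).norm
  set S : ℝ := ∑ j, ∑' α, ‖seriesTerm (h j) (fun _ => (r : ℂ)) α‖ with hS
  have hS0 : 0 ≤ S := Finset.sum_nonneg fun j _ => tsum_nonneg fun _ => norm_nonneg _
  refine ⟨(S + 1) / r, fun j α => ?_⟩
  rcases Nat.eq_zero_or_pos α.degree with hα | hα
  · rw [hα, (Finsupp.degree_eq_zero_iff α).1 hα,
      MvPowerSeries.coeff_zero_eq_constantCoeff_apply, h0]
    simp
  · rw [div_pow, le_div_iff₀ (by positivity), ← norm_seriesTerm_const (h j) hrpos.le α]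
    calc ‖seriesTerm (h j) (fun _ => (r : ℂ)) α‖
        ≤ ∑' α, ‖seriesTerm (h j) (fun _ => (r : ℂ)) α‖ :=
          (hsum j).le_tsum α fun _ _ => norm_nonneg _
      _ ≤ S := Finset.single_le_sum (f := fun j => ∑' α, ‖seriesTerm (h j) (fun _ => (r : ℂ)) α‖)
          (fun j _ => tsum_nonneg fun _ => norm_nonneg _) (Finset.mem_univ j)
      _ ≤ S + 1 := by linarith
      _ ≤ (S + 1) ^ α.degree := le_self_pow₀ (by linarith) (by omega)

lemma polyOnLines_eval {m D : ℕ} (p : MvPolynomial (Fin m) ℂ) (hp : p.totalDegree ≤ D) :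
    PolyOnLines D fun t => MvPolynomial.eval t p := by
  intro a b
  refine ⟨MvPolynomial.aeval (fun i => Polynomial.C (a i) + Polynomial.C (b i) * Polynomial.X) p,
    ?_, fun s => ?_⟩
  · have h1 := MvPolynomial.aeval_natDegree_le (m := D) (n := 1) p hp
      (fun i => Polynomial.C (a i) + Polynomial.C (b i) * Polynomial.X)
      (fun i => by compute_degree)
    simpa using h1
  · change MvPolynomial.eval (a + s • b) p = _
    rw [← Polynomial.coe_evalRingHom, MvPolynomial.aeval_def, MvPolynomial.eval₂_eq', map_sum,
      MvPolynomial.eval_eq']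
    refine Finset.sum_congr rfl fun d _ => ?_
    simp only [← Polynomial.C_eq_algebraMap, map_mul, map_prod, map_pow, map_add,
      Polynomial.coe_evalRingHom, Polynomial.eval_C, Polynomial.eval_X, Pi.add_apply,
      Pi.smul_apply, smul_eq_mul, mul_comm s]

/-- If a family of formal maps whose coefficients are polynomials in the parameter, of degree at
most affine in the order, converges on a set of parameters of positive `Γ`-capacity, then it
converges for all parameters. -/
lemma converges_of_gammaCapacity_ne_zero {m : ℕ} (hm : 1 ≤ m) {h : (Fin m → ℂ) → FormalMap n}
    (h0 : ∀ t j, MvPowerSeries.constantCoeff (h t j) = 0) {C₀ C₁ : ℝ}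
    (h_poly : ∀ (j : Fin n) (α : Fin n →₀ ℕ), ∃ p : MvPolynomial (Fin m) ℂ,
      (p.totalDegree : ℝ) ≤ C₀ + C₁ * (α.degree : ℝ) ∧
      ∀ t, MvPowerSeries.coeff α (h t j) = MvPolynomial.eval t p)
    (hcap : gammaCapacity {t | (h t).Converges} ≠ 0) (t : Fin m → ℂ) : (h t).Converges := by
  choose P hPdeg hP using h_poly
  set E : ℕ → Set (Fin m → ℂ) := fun k =>
    Metric.closedBall 0 k ∩ {t | ∀ j α, ‖MvPolynomial.eval t (P j α)‖ ≤ (k : ℝ) ^ α.degree} with hE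
  have hmono : Monotone E := by
    intro k l hkl t ht
    have hkl' : (k : ℝ) ≤ l := by exact_mod_cast hkl
    exact ⟨Metric.closedBall_subset_closedBall hkl' ht.1, fun j α =>
      (ht.2 j α).trans (by gcongr)⟩
  have hcomp : ∀ k, IsCompact (E k) := by
    intro k
    refine (isCompact_closedBall _ _).inter_right ?_
    have heq : {t | ∀ j α, ‖MvPolynomial.eval t (P j α)‖ ≤ (k : ℝ) ^ α.degree} =
        ⋂ j, ⋂ α, {t | ‖MvPolynomial.eval t (P j α)‖ ≤ (k : ℝ) ^ α.degree} := by
      ext t; simp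
    rw [heq]
    exact isClosed_iInter fun j => isClosed_iInter fun α =>
      isClosed_le (MvPolynomial.continuous_eval (P j α)).norm continuous_const
  have hsub : {t | (h t).Converges} ⊆ ⋃ k, E k := by
    intro t ht
    obtain ⟨b, hb⟩ := FormalMap.Converges.exists_norm_coeff_le ht (h0 t)
    obtain ⟨k, hk⟩ := exists_nat_ge (max ‖t‖ |b|)
    refine Set.mem_iUnion.2 ⟨k, by simpa using (le_max_left _ _).trans hk, fun j α => ?_⟩
    rw [← hP]
    calc _ ≤ b ^ α.degree := hb j α
      _ ≤ |b| ^ α.degree := (le_abs_self _).trans (abs_pow b _).le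
      _ ≤ _ := by gcongr; exact (le_max_right _ _).trans hk
  have hcap' : gammaCapacity (⋃ k, E k) ≠ 0 := fun h1 =>
    hcap (le_antisymm ((gammaCapacity_mono hsub).trans h1.le) zero_le)
  obtain ⟨k, C, hC⟩ := exists_growth_of_gammaCapacity_ne_zero hm hmono hcomp hcap'
  set c : ℝ := max (C t) 1 with hc
  have hc1 : 1 ≤ c := le_max_right _ _
  refine FormalMap.converges_of_norm_coeff_le (a := c ^ ⌈C₀⌉₊) (b := c ^ ⌈C₁⌉₊ * k)
    (by positivity) fun j α => ?_
  have hdeg : (P j α).totalDegree ≤ ⌈C₀⌉₊ + ⌈C₁⌉₊ * α.degree := by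
    have h1 : ((P j α).totalDegree : ℝ) ≤ ⌈C₀⌉₊ + ⌈C₁⌉₊ * α.degree :=
      (hPdeg j α).trans (by gcongr <;> exact Nat.le_ceil _)
    exact_mod_cast h1
  obtain ⟨t', ht', hle⟩ := (hC t).2 _ _ (polyOnLines_eval (P j α) hdeg)
  rw [hP]
  calc ‖MvPolynomial.eval t (P j α)‖
      ≤ C t ^ (⌈C₀⌉₊ + ⌈C₁⌉₊ * α.degree) * ‖MvPolynomial.eval t' (P j α)‖ := hle
    _ ≤ c ^ (⌈C₀⌉₊ + ⌈C₁⌉₊ * α.degree) * (k : ℝ) ^ α.degree := by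
        gcongr
        · exact (hC t).1
        · exact le_max_left _ _
        · exact ht'.2 j α
    _ = c ^ ⌈C₀⌉₊ * (c ^ ⌈C₁⌉₊ * k) ^ α.degree := by
        rw [pow_add, pow_mul, mul_pow, mul_assoc]

lemma polyFamily_zero {m d : ℕ} (A : Matrix (Fin n) (Fin n) ℂ)
    {f : (Fin m → ℕ) → (Fin n → ℂ) → (Fin n → ℂ)} (hf : ∀ i, ∑ k, i k ≤ d → f i 0 = 0)
    (t : Fin m → ℂ) : polyFamily A d f t 0 = 0 := by
  rw [polyFamily, Matrix.mulVec_zero, zero_add]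
  refine Finset.sum_eq_zero fun i hi => ?_
  rw [hf i (Finset.mem_filter.1 hi).2, smul_zero]

end SmallDivisors

theorem theorem2 (n m d : ℕ) (hn : 1 ≤ n) (hm : 1 ≤ m)
    (A : Matrix.GeneralLinearGroup (Fin n) ℂ)
    (f : (Fin m → ℕ) → (Fin n → ℂ) → (Fin n → ℂ))
    (hf_holo : ∀ i, ∑ k, i k ≤ d → AnalyticAt ℂ (f i) 0)
    (hf_val : ∀ i, ∑ k, i k ≤ d → f i =O[𝓝 0] fun z => ‖z‖ ^ 2)
    (h : (Fin m → ℂ) → SmallDivisors.FormalMap n)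
    (h_lin : ∀ t, SmallDivisors.IsFormalLinearization (A : Matrix (Fin n) (Fin n) ℂ)
      (SmallDivisors.polyFamily (A : Matrix (Fin n) (Fin n) ℂ) d f t) (h t))
    (C₀ C₁ : ℝ) (hC₀ : 0 < C₀) (hC₁ : 0 < C₁)
    (h_poly : ∀ (j : Fin n) (α : Fin n →₀ ℕ), ∃ p : MvPolynomial (Fin m) ℂ,
      (p.totalDegree : ℝ) ≤ C₀ + C₁ * (α.degree : ℝ) ∧
      ∀ t, MvPowerSeries.coeff α (h t j) = MvPolynomial.eval t p) :
    Xor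
      (∀ t, SmallDivisors.HolomorphicallyLinearizes (A : Matrix (Fin n) (Fin n) ℂ)
        (SmallDivisors.polyFamily (A : Matrix (Fin n) (Fin n) ℂ) d f t) (h t))
      (SmallDivisors.gammaCapacity {t | ¬ (h t).Diverges} = 0) := by
  have hset : {t | ¬ (h t).Diverges} = {t | (h t).Converges} := by
    ext t
    exact not_not
  have hzero : ∀ t, SmallDivisors.polyFamily (A : Matrix (Fin n) (Fin n) ℂ) d f t 0 = 0 :=
    SmallDivisors.polyFamily_zero _ fun i hi => by
      obtain ⟨c, hc⟩ := (hf_val i hi).bound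
      simpa using hc.self_of_nhds
  rw [hset]
  by_cases hcap : SmallDivisors.gammaCapacity {t | (h t).Converges} = 0
  · refine Or.inr ⟨hcap, fun hall => ?_⟩
    have huniv : {t | (h t).Converges} = Set.univ := by
      refine Set.eq_univ_of_forall fun t => ?_
      obtain ⟨H, hH, -⟩ := hall t
      exact hH.mono fun z hz j => (hz j).summable
    rw [huniv] at hcap
    exact SmallDivisors.gammaCapacity_univ_ne_zero hm hcap
  · exact Or.inl ⟨fun t => (h_lin t).holomorphicallyLinearizes (hzero t)
      (SmallDivisors.converges_of_gammaCapacity_ne_zero hm (fun t => (h_lin t).1) h_poly hcap t),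
      hcap⟩
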